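/- Consider the $K$-armed Gaussian bandit: at round $t=1,\dots,T$ a player picks an arm $A_t\in\{1,\dots,K\}$ on the basis of the past arms and rewards and receives $R_t=\mu_{A_t}+\sigma\xi_t$, where $\sigma>0$ and $\xi_1,\dots,\xi_T$ are i.i.d. $\mathcal N(0,1)$. Let $\mu_*=\max_b\mu_b$ and $\Delta_a=\mu_*-\mu_a$. The UCB1 rule with exploration rate $\gamma_T>0$ pulls each arm once in the first $K$ rounds and afterwards picks $A_t\in\arg\max_a\{\hat\mu_{a;t-1}+\sigma\gamma_T/\sqrt{n_{a;t-1}}\}$, where $n_{a;t}$ is the number of pulls of arm $a$ up to round $t$ and $\hat\mu_{a;t}$ is the average of the rewards obtained from arm $a$ up to round $t$ (ties are broken in any measurable way). Let $R(\Delta)=\mathbb E\sum_{t\le T}\Delta_{A_t}$ be its expected regret. Put $\gamma_T=\sqrt{2\log T}$ and $\epsilon_{T,K}=\sqrt{\log\log T/\log T}+K/T$. Let $\mathcal D_K$ be the set of gap vectors, i.e. of all $\Delta\in\mathbb R_{\ge0}^K$ with $\min_a\Delta_a=0$, and let $\mathcal D_{K,T}$ be the set of those $\Delta\in\mathcal D_K$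 with $\max_a\Delta_a\le\sigma\gamma_T\sqrt{K/T}$. There are a universal constant $C>0$ and a function $T_0:\mathbb R\to\mathbb N$ such that for all $K\ge2$ and $T\ge1$ with $K/T\le 1/C$, all $\sigma>0$ and every value of $\mu_*$, UCB1 with $\gamma_T=\sqrt{2\log T}$ satisfies: 1. $\displaystyle\sup_{\Delta\in\mathcal D_K}\frac{R(\Delta)}{\sigma}\ \ge\ \Big(\frac1{\sqrt8}-C\epsilon_{T,K}\Big)_+\sqrt{TK\log T}$. 2. Already over moderate gaps, $\displaystyle\sup_{\Delta\in\mathcal D_{K,T}}\frac{R(\Delta)}{\sigma}\ \ge\ \Big(\frac{1-1/K}{\sqrt8}-C\epsilon_{T,K}\Big)_+\sqrt{TK\log T}$. 3. If $K\ge4$, then $\displaystyle\sup_{\Delta\in\mathcal D_{K,T}}\frac{R(\Delta)}{\sigma}\ \ge\ \Big(\frac1{\sqrt8}-C\epsilon_{T,K}\Big)_+\sqrt{TK\log T}$. 4. UCB1 is not minimax optimal: for every $M\in\mathbb R$, if $T\ge T_0(M)$, then $\displaystyle\sup_{\Delta\in\mathcal D_{K,T}}R(\Delta)>M\,\sigma\sqrt{KT}$.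 (The suprema are taken in $[-\infty,\infty]$.) -/

import Mathlib

open MeasureTheory ProbabilityTheory
open scoped BigOperators

universe u

noncomputable section

namespace Bandit

/-- A (deterministic) bandit policy with `K` arms: the arm played after `t` completed rounds is a
measurable function of the arms played and the rewards received in these `t` rounds. -/
structure Policy (K : ℕ) where
  act : (t : ℕ) → (Fin t → Fin K × ℝ) → Fin K
  measurable_act : ∀ t, Measurable (act t)

/-- Number of pulls of the arm `a` in the history `h`. -/
def pullCount {K t : ℕ} (h : Fin t → Fin K × ℝ) (a : Fin K) : ℕ :=
  (Finset.univ.filter fun s => (h s).1 = a).card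

/-- Average of the rewards received from the arm `a` in the history `h`. -/
def empMean {K t : ℕ} (h : Fin t → Fin K × ℝ) (a : Fin K) : ℝ :=
  (∑ s ∈ Finset.univ.filter (fun s => (h s).1 = a), (h s).2) / (pullCount h a : ℝ)

/-- The over-estimated mean of the arm `a` after the history `h`. -/
def ucbIndex {K t : ℕ} (σ γ : ℝ) (h : Fin t → Fin K × ℝ) (a : Fin K) : ℝ :=
  empMean h a + σ * γ / Real.sqrt (pullCount h a : ℝ)

/-- `π` is a version of the UCB1 rule with noise level `σ` and exploration rate `γ`: in the first
`K` rounds every arm is pulled once (an arm not pulled before is chosen, in any order), and from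
then on the arm maximizes the over-estimated mean, with ties broken in any measurable way. -/
structure IsUCB1 {K : ℕ} (π : Policy K) (σ γ : ℝ) : Prop where
  initial : ∀ (t : ℕ) (h : Fin t → Fin K × ℝ), t < K → pullCount h (π.act t h) = 0
  greedy : ∀ (t : ℕ) (h : Fin t → Fin K × ℝ), K ≤ t → (∀ a, 0 < pullCount h a) →
    ∀ a, ucbIndex σ γ h a ≤ ucbIndex σ γ h (π.act t h)

/-- The first `t` rounds (arm, reward) when `π` is played against mean rewards `μ`, noise level `σ`
and noise realization `z`: the reward of a round is the mean of the arm plus `σ` times the noise of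
that round. Rounds are numbered from `0`. -/
def history {K : ℕ} (π : Policy K) (μ : Fin K → ℝ) (σ : ℝ) (z : ℕ → ℝ) :
    (t : ℕ) → Fin t → Fin K × ℝ
  | 0 => Fin.elim0
  | t + 1 =>
    Fin.snoc (α := fun _ => Fin K × ℝ) (history π μ σ z t)
      (π.act t (history π μ σ z t), μ (π.act t (history π μ σ z t)) + σ * z t)

/-- The arm played in round `t` (rounds are numbered from `0`). -/
def arm {K : ℕ} (π : Policy K) (μ : Fin K → ℝ) (σ : ℝ) (z : ℕ → ℝ) (t : ℕ) : Fin K :=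
  π.act t (history π μ σ z t)

/-- The noises of the rounds `0, …, T - 1` are i.i.d. standard normal. -/
structure IsGaussianNoise {Ω : Type u} [MeasurableSpace Ω] (P : Measure Ω) (T : ℕ)
    (ξ : ℕ → Ω → ℝ) : Prop where
  law : ∀ t < T, HasLaw (ξ t) (gaussianReal 0 1) P
  indep : iIndepFun (fun t : Fin T => ξ t) P

/-- Sub-optimality gap of the arm `a`. -/
def gap {K : ℕ} (μ : Fin K → ℝ) (a : Fin K) : ℝ := (⨆ b, μ b) - μ a

/-- Expected regret over `T` rounds. -/
def regret {Ω : Type u} [MeasurableSpace Ω] (P : Measure Ω) (ξ : ℕ → Ω → ℝ) {K : ℕ}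
    (π : Policy K) (μ : Fin K → ℝ) (σ : ℝ) (T : ℕ) : ℝ :=
  ∫ ω, ∑ t ∈ Finset.range T, gap μ (arm π μ σ (fun s => ξ s ω) t) ∂P

/-- Vectors of sub-optimality gaps: nonnegative, with at least one optimal arm. -/
def gapVectors (K : ℕ) : Set (Fin K → ℝ) :=
  {Δ | (∀ a, 0 ≤ Δ a) ∧ ∃ a, Δ a = 0}

/-- Gap vectors all of whose entries are at most `r`. -/
def boundedGapVectors (K : ℕ) (r : ℝ) : Set (Fin K → ℝ) :=
  {Δ | Δ ∈ gapVectors K ∧ ∀ a, Δ a ≤ r}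

/-- Supremum, over the gap vectors in `D`, of the regret divided by `σ`; the best mean is `m`. -/
def maxScaledRegret {Ω : Type u} [MeasurableSpace Ω] (P : Measure Ω) (ξ : ℕ → Ω → ℝ) {K : ℕ}
    (π : Policy K) (m σ : ℝ) (T : ℕ) (D : Set (Fin K → ℝ)) : EReal :=
  ⨆ Δ ∈ D, ((regret P ξ π (fun a => m - Δ a) σ T / σ : ℝ) : EReal)

/-- The exploration rate `√(2 log T)`. -/
def rate (T : ℕ) : ℝ := Real.sqrt (2 * Real.log T)

/-- The error term `√(log log T / log T) + K / T`. -/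
def err (T K : ℕ) : ℝ :=
  Real.sqrt (Real.log (Real.log T) / Real.log T) + (K : ℝ) / T

end Bandit

end

/-! Give one arm `o` the best mean and all others the gap `d = σγ√(K/T)`. Suppose `o` is about to be
pulled again after at least `xT` pulls. Up to noise its index is at most its mean plus `σγ/√(xT)`,
and no other index exceeds it. As the means differ by only `d`, this forces every other arm to have
about `T/(K(1 + 1/√(xK))²)` pulls already. For suitable `x` these add up to more than the `(1 - x)T`
rounds available (`IsUCB1.exists_noise_large`). So with high probability `o` gets at most about `xT`
pulls, and the regret is about `d(1 - x)T = σγ√(KT)(1 - x)`. Since `√(TK log T)/√8 = γ√(KT)/4`, it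
suffices that `1 - x` exceeds `1/4`, or `(1 - 1/K)/4`, with a little slack.

The noise must be controlled at the random round in question. Stopping the selection of rounds by
the pull count of `o` makes each arm's noise sum a predictably selected sum, to which an exponential
martingale and dyadic peeling apply (`IsGaussianNoise.measure_sel_le`). No union bound over the arms
is needed: Markov's inequality bounds the number of bad arms, and `δK` of them are tolerated
(`IsUCB1.measure_pulls_le`).

With `δ = 1/100` fixed, the slack absorbs all errors for large `T`, which a large `C` enforces; the
error term is simply dropped. Over unbounded gaps the supremum is infinite. -/

namespace Bandit

/-! ### Deviations of predictably selected Gaussian sums -/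

section Noise

variable {Ω : Type u}

/-- The σ-algebra generated by the noises of the rounds before `t`. -/
@[reducible] def past (ξ : ℕ → Ω → ℝ) (t : ℕ) : MeasurableSpace Ω :=
  ⨆ s ∈ {s : ℕ | s < t}, MeasurableSpace.comap (ξ s) inferInstance

lemma measurable_past (ξ : ℕ → Ω → ℝ) {s t : ℕ} (h : s < t) : Measurable[past ξ t] (ξ s) := by
  have h1 : MeasurableSpace.comap (ξ s) inferInstance ≤ past ξ t :=
    le_iSup₂_of_le (f := fun s (_ : s ∈ {s : ℕ | s < t}) =>
      MeasurableSpace.comap (ξ s) inferInstance) s h le_rfl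
  exact (comap_measurable (ξ s)).mono h1 le_rfl

lemma past_mono (ξ : ℕ → Ω → ℝ) {s t : ℕ} (h : s ≤ t) : past ξ s ≤ past ξ t :=
  biSup_mono fun _ hr => lt_of_lt_of_le hr h

/-- Sum of the noises of those of the first `t` rounds that are selected by `B`. -/
noncomputable def selSum (ξ : ℕ → Ω → ℝ) (B : ℕ → Set Ω) (t : ℕ) (ω : Ω) : ℝ :=
  ∑ s ∈ Finset.range t, (B s).indicator (ξ s) ω

/-- Number of those of the first `t` rounds that are selected by `B`. -/
noncomputable def selCount (B : ℕ → Set Ω) (t : ℕ) (ω : Ω) : ℝ :=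
  ∑ s ∈ Finset.range t, (B s).indicator (fun _ => (1 : ℝ)) ω

lemma measurable_selSum {B : ℕ → Set Ω} (hB : ∀ t, MeasurableSet[past ξ t] (B t)) (t : ℕ) :
    Measurable[past ξ t] (selSum ξ B t) := by
  unfold selSum
  refine Finset.measurable_fun_sum _ fun s hs => ?_
  have hs := Finset.mem_range.1 hs
  exact (measurable_past ξ hs).indicator (past_mono ξ hs.le _ (hB s))

lemma measurable_selCount {B : ℕ → Set Ω} (hB : ∀ t, MeasurableSet[past ξ t] (B t)) (t : ℕ) :
    Measurable[past ξ t] (selCount B t) := by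
  unfold selCount
  refine Finset.measurable_fun_sum _ fun s hs => ?_
  have hs := Finset.mem_range.1 hs
  exact measurable_const.indicator (past_mono ξ hs.le _ (hB s))

lemma selCount_eq_natCast (B : ℕ → Set Ω) (t : ℕ) (ω : Ω) :
    ∃ n : ℕ, n ≤ t ∧ selCount B t ω = n := by
  classical
  refine ⟨((Finset.range t).filter fun s => ω ∈ B s).card, ?_, ?_⟩
  · simpa using Finset.card_filter_le (Finset.range t) fun s => ω ∈ B s
  · simp [selCount, Set.indicator_apply]

variable [mΩ : MeasurableSpace Ω] {P : Measure Ω} {T : ℕ} {ξ : ℕ → Ω → ℝ}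

lemma past_le (hm : ∀ t, Measurable (ξ t)) (t : ℕ) : past ξ t ≤ mΩ :=
  iSup₂_le fun s _ => (hm s).comap_le

lemma IsGaussianNoise.indep_past (hξ : IsGaussianNoise P T ξ) (hm : ∀ t, Measurable (ξ t))
    {t : ℕ} (ht : t < T) :
    Indep (past ξ t) (MeasurableSpace.comap (ξ t) inferInstance) P := by
  have h := indep_iSup_of_disjoint (fun i : Fin T => (hm i).comap_le) hξ.indep.iIndep
    (S := {i : Fin T | (i : ℕ) < t}) (T := {⟨t, ht⟩})
    (Set.disjoint_singleton_right.2 (lt_irrefl t))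
  rw [iSup_singleton] at h
  refine indep_of_indep_of_le_left h (iSup₂_le fun s hs => ?_)
  exact le_biSup (fun i : Fin T => MeasurableSpace.comap (ξ i) inferInstance)
    (show (⟨s, lt_trans hs ht⟩ : Fin T) ∈ {i : Fin T | (i : ℕ) < t} from hs)

lemma IsGaussianNoise.lintegral_exp (hξ : IsGaussianNoise P T ξ) {t : ℕ} (ht : t < T) (l : ℝ) :
    ∫⁻ ω, ENNReal.ofReal (Real.exp (l * ξ t ω - l ^ 2 / 2)) ∂P = 1 := by
  rw [(hξ.law t ht).lintegral_comp (f := fun x => ENNReal.ofReal (Real.exp (l * x - l ^ 2 / 2)))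
    (by fun_prop)]
  have h1 : Integrable (fun x => Real.exp (l * x - l ^ 2 / 2)) (gaussianReal 0 1) := by
    simp_rw [Real.exp_sub]
    exact (integrable_exp_mul_gaussianReal l).div_const _
  rw [← ofReal_integral_eq_lintegral_ofReal h1 (ae_of_all _ fun _ => (Real.exp_pos _).le)]
  simp_rw [Real.exp_sub]
  rw [integral_div]
  have h2 := congrFun (mgf_id_gaussianReal (μ := 0) (v := 1)) l
  simp only [mgf, id] at h2
  rw [h2]
  simp

/-- The exponential martingale of the selected sum: a selected round multiplies it by an independent
factor of mean one, any other round leaves it unchanged. -/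
lemma IsGaussianNoise.lintegral_exp_sel [IsProbabilityMeasure P] (hξ : IsGaussianNoise P T ξ)
    (hm : ∀ t, Measurable (ξ t)) {B : ℕ → Set Ω} (hB : ∀ t, MeasurableSet[past ξ t] (B t))
    (l : ℝ) : ∀ t ≤ T,
    ∫⁻ ω, ENNReal.ofReal (Real.exp (l * selSum ξ B t ω - l ^ 2 / 2 * selCount B t ω)) ∂P = 1 := by
  intro t
  induction t with
  | zero => intro _; simp [selSum, selCount]
  | succ t ih =>
    intro ht
    have ih := ih (by omega)
    set W : Ω → ENNReal := fun ω =>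
      ENNReal.ofReal (Real.exp (l * selSum ξ B t ω - l ^ 2 / 2 * selCount B t ω)) with hW
    set e : Ω → ENNReal := fun ω => ENNReal.ofReal (Real.exp (l * ξ t ω - l ^ 2 / 2)) with he
    have hWm : Measurable[past ξ t] W := by
      have h1 := measurable_selSum hB t
      have h2 := measurable_selCount hB t
      exact ENNReal.measurable_ofReal.comp (Real.measurable_exp.comp
        ((h1.const_mul l).sub (h2.const_mul (l ^ 2 / 2))))
    have hem : Measurable[MeasurableSpace.comap (ξ t) inferInstance] e := by
      have h1 : Measurable[MeasurableSpace.comap (ξ t) inferInstance] (ξ t) :=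
        comap_measurable (ξ t)
      exact ENNReal.measurable_ofReal.comp (Real.measurable_exp.comp
        ((h1.const_mul l).sub_const (l ^ 2 / 2)))
    have hle := past_le hm t
    have hsplit : ∀ ω, ENNReal.ofReal (Real.exp (l * selSum ξ B (t + 1) ω
        - l ^ 2 / 2 * selCount B (t + 1) ω))
        = (B t).indicator W ω * e ω + (B t)ᶜ.indicator W ω := by
      intro ω
      by_cases hω : ω ∈ B t
      · have : l * selSum ξ B (t + 1) ω - l ^ 2 / 2 * selCount B (t + 1) ω
          = (l * selSum ξ B t ω - l ^ 2 / 2 * selCount B t ω) + (l * ξ t ω - l ^ 2 / 2) := by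
          simp only [selSum, selCount, Finset.sum_range_succ, Set.indicator_of_mem hω]
          ring
        rw [this, Real.exp_add, ENNReal.ofReal_mul (Real.exp_pos _).le]
        simp [hω, hW, he]
      · simp [selSum, selCount, Finset.sum_range_succ, hω, hW]
    simp_rw [hsplit]
    have hWB : Measurable[past ξ t] ((B t).indicator W) := hWm.indicator (hB t)
    have hWB' : Measurable[past ξ t] ((B t)ᶜ.indicator W) := hWm.indicator (hB t).compl
    rw [lintegral_add_right _ (hWB'.mono hle le_rfl),
      lintegral_mul_eq_lintegral_mul_lintegral_of_independent_measurableSpace hle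
        (hm t).comap_le (hξ.indep_past hm (by omega)) hWB hem,
      hξ.lintegral_exp (by omega), mul_one, ← lintegral_add_right _ (hWB'.mono hle le_rfl), ← ih]
    refine lintegral_congr fun ω => ?_
    by_cases hω : ω ∈ B t <;> simp [hω, hW]

/-- Markov's inequality for the exponential martingale. The sign of `c` chooses the tail: the event
is `S ≥ c√N` for `c > 0` and `S ≤ c√N` for `c < 0`. -/
lemma IsGaussianNoise.measure_dyadic_le [IsProbabilityMeasure P] (hξ : IsGaussianNoise P T ξ)
    (hm : ∀ t, Measurable (ξ t)) {B : ℕ → Set Ω} (hB : ∀ t, MeasurableSet[past ξ t] (B t))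
    (c : ℝ) {v : ℝ} (hv : 0 < v) :
    P {ω | v ^ 2 ≤ selCount B T ω ∧ selCount B T ω ≤ 2 * v ^ 2 ∧
      c ^ 2 * Real.sqrt (selCount B T ω) ≤ c * selSum ξ B T ω}
      ≤ ENNReal.ofReal (Real.exp (-(c ^ 2 / 4))) := by
  -- One tilt serves the whole block `v² ≤ N ≤ 2v²`: there the linear term is at least `c²/2` and
  -- the quadratic one at most `c²/4`.
  set l : ℝ := c / (2 * v) with hl
  have h1 := hξ.lintegral_exp_sel hm hB l T le_rfl
  have hle := past_le hm T
  have hmeas : AEMeasurable (fun ω => ENNReal.ofReal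
      (Real.exp (l * selSum ξ B T ω - l ^ 2 / 2 * selCount B T ω))) P := by
    have h1 := (measurable_selSum hB T).mono hle le_rfl
    have h2 := (measurable_selCount hB T).mono hle le_rfl
    fun_prop
  have h2 := meas_ge_le_lintegral_div hmeas (ε := ENNReal.ofReal (Real.exp (c ^ 2 / 4)))
    (by simp [Real.exp_pos]) (by simp)
  rw [h1, one_div, ← ENNReal.ofReal_inv_of_pos (Real.exp_pos _), ← Real.exp_neg] at h2
  refine (measure_mono ?_).trans h2
  rintro ω ⟨ha, hb, hc⟩
  refine ENNReal.ofReal_le_ofReal (Real.exp_le_exp.2 ?_)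
  set N := selCount B T ω
  set S := selSum ξ B T ω
  have hN : 0 ≤ N := le_trans (by positivity) ha
  set r := Real.sqrt N with hr
  have hrN : r ^ 2 = N := Real.sq_sqrt hN
  have hvr : v ≤ r := Real.le_sqrt_of_sq_le ha
  have e1 : l * S = c * S / (2 * v) := by rw [hl]; ring
  have e2 : c ^ 2 * r / (2 * v) ≤ c * S / (2 * v) := by gcongr
  have e3 : l ^ 2 / 2 * N ≤ c ^ 2 / 4 := by
    rw [hl, div_pow, div_div, div_mul_eq_mul_div, div_le_div_iff₀ (by positivity) (by norm_num)]
    nlinarith [mul_le_mul_of_nonneg_left hb (sq_nonneg c)]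
  have e4 : c ^ 2 / 2 ≤ c ^ 2 * r / (2 * v) := by
    rw [div_le_div_iff₀ (by norm_num) (by positivity)]
    nlinarith [mul_le_mul_of_nonneg_left hvr (sq_nonneg c)]
  rw [e1]; linarith

/-- A tail bound for the sum of predictably selected Gaussian noises, at the scale of the square root
of their random number. -/
lemma IsGaussianNoise.measure_sel_le [IsProbabilityMeasure P] (hξ : IsGaussianNoise P T ξ)
    (hm : ∀ t, Measurable (ξ t)) {B : ℕ → Set Ω} (hB : ∀ t, MeasurableSet[past ξ t] (B t))
    (c : ℝ) :
    P {ω | 1 ≤ selCount B T ω ∧ c ^ 2 * Real.sqrt (selCount B T ω) ≤ c * selSum ξ B T ω}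
      ≤ ENNReal.ofReal ((Nat.log 2 T + 1 : ℕ) * Real.exp (-(c ^ 2 / 4))) := by
  -- Peeling: the block index is the binary logarithm of the number of selected rounds.
  have hsub : {ω | 1 ≤ selCount B T ω ∧
      c ^ 2 * Real.sqrt (selCount B T ω) ≤ c * selSum ξ B T ω} ⊆
      ⋃ j ∈ Finset.range (Nat.log 2 T + 1), {ω | Real.sqrt (2 ^ j) ^ 2 ≤ selCount B T ω ∧
        selCount B T ω ≤ 2 * Real.sqrt (2 ^ j) ^ 2 ∧
        c ^ 2 * Real.sqrt (selCount B T ω) ≤ c * selSum ξ B T ω} := by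
    rintro ω ⟨h1, h2⟩
    obtain ⟨n, hnT, hn⟩ := selCount_eq_natCast B T ω
    have hn0 : n ≠ 0 := by
      rintro rfl
      rw [hn] at h1
      norm_num at h1
    refine Set.mem_biUnion (x := Nat.log 2 n)
      (by simpa [Nat.lt_succ_iff] using Nat.log_mono_right hnT) ⟨?_, ?_, h2⟩
    · rw [hn, Real.sq_sqrt (by positivity)]
      exact_mod_cast Nat.pow_log_le_self 2 hn0
    · rw [hn, Real.sq_sqrt (by positivity), ← pow_succ']
      exact_mod_cast (Nat.lt_pow_succ_log_self one_lt_two n).le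
  refine (measure_mono hsub).trans ((measure_biUnion_finset_le _ _).trans ?_)
  refine (Finset.sum_le_sum fun j _ => hξ.measure_dyadic_le hm hB c
    (v := Real.sqrt (2 ^ j)) (by positivity)).trans ?_
  rw [Finset.sum_const, Finset.card_range, nsmul_eq_mul,
    ENNReal.ofReal_mul (Nat.cast_nonneg _), ENNReal.ofReal_natCast]

/-- Gaussian noises agree almost surely with measurable ones. -/
lemma IsGaussianNoise.exists_measurable (hξ : IsGaussianNoise P T ξ) :
    ∃ ξ' : ℕ → Ω → ℝ, (∀ t, Measurable (ξ' t)) ∧ IsGaussianNoise P T ξ' ∧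
      ∀ t < T, ξ t =ᵐ[P] ξ' t := by
  let ξ' : ℕ → Ω → ℝ := fun t =>
    if h : t < T then (hξ.law t h).aemeasurable.mk (ξ t) else 0
  have h0 : ∀ t < T, ξ t =ᵐ[P] ξ' t := by
    intro t ht
    simp only [ξ', ht, dite_true]
    exact (hξ.law t ht).aemeasurable.ae_eq_mk
  refine ⟨ξ', fun t => ?_, ⟨fun t ht => (hξ.law t ht).congr (h0 t ht).symm,
    hξ.indep.congr fun i => h0 i i.2⟩, h0⟩
  by_cases ht : t < T
  · simp only [ξ', ht, dite_true]
    exact (hξ.law t ht).aemeasurable.measurable_mk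
  · simp only [ξ', ht, dite_false]
    exact measurable_const

end Noise

/-! ### Deterministic analysis of a single trajectory -/

section Path

variable {K : ℕ} (π : Policy K) (μ : Fin K → ℝ) (σ : ℝ)

lemma history_apply (z : ℕ → ℝ) (t : ℕ) (s : Fin t) :
    history π μ σ z t s = (arm π μ σ z s, μ (arm π μ σ z s) + σ * z s) := by
  induction t with
  | zero => exact s.elim0
  | succ t ih =>
    refine Fin.lastCases ?_ (fun i => ?_) s
    · simp [history, arm]
    · simp [history, ih i]

lemma arm_congr {z z' : ℕ → ℝ} (t : ℕ) (h : ∀ s < t, z s = z' s) :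
    arm π μ σ z t = arm π μ σ z' t := by
  induction t using Nat.strong_induction_on with
  | _ t ih =>
    have : history π μ σ z t = history π μ σ z' t := by
      funext s
      rw [history_apply, history_apply, h s s.2, ih s s.2 fun r hr => h r (hr.trans s.2)]
    rw [arm, arm, this]

lemma measurable_arm {Ω : Type u} [MeasurableSpace Ω] {ξ : ℕ → Ω → ℝ} (t : ℕ)
    (h : ∀ s < t, Measurable (ξ s)) : Measurable fun ω => arm π μ σ (fun s => ξ s ω) t := by
  induction t using Nat.strong_induction_on with
  | _ t ih =>
    refine (π.measurable_act t).comp (measurable_pi_iff.2 fun s => ?_)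
    simp_rw [history_apply]
    have h1 := ih s s.2 fun r hr => h r (hr.trans s.2)
    exact h1.prodMk (((measurable_of_finite μ).comp h1).add ((h s s.2).const_mul σ))

/-- Number of pulls of the arm `a` in the first `t` rounds, if `A s` is the arm of round `s`. -/
def pulls (A : ℕ → Fin K) (a : Fin K) (t : ℕ) : ℕ := Nat.count (fun s => A s = a) t

/-- Sum of the noises that the arm `a` receives in the first `t` rounds. -/
noncomputable def noiseSum (A : ℕ → Fin K) (z : ℕ → ℝ) (a : Fin K) (t : ℕ) : ℝ :=
  ∑ s ∈ Finset.range t, if A s = a then z s else 0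

lemma pulls_succ (A : ℕ → Fin K) (a : Fin K) (t : ℕ) :
    pulls A a (t + 1) = pulls A a t + if A t = a then 1 else 0 := Nat.count_succ _ _

lemma pulls_mono (A : ℕ → Fin K) (a : Fin K) : Monotone (pulls A a) := Nat.count_monotone _

lemma sum_pulls (A : ℕ → Fin K) (t : ℕ) : ∑ a, pulls A a t = t := by
  induction t with
  | zero => simp [pulls]
  | succ t ih => simp [pulls_succ, Finset.sum_add_distrib, ih]

lemma pulls_eq_sum (A : ℕ → Fin K) (a : Fin K) (t : ℕ) :
    pulls A a t = ∑ s ∈ Finset.range t, if A s = a then 1 else 0 := by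
  rw [pulls, Nat.count_eq_card_filter_range, Finset.card_filter]

lemma exists_pulls_eq (A : ℕ → Fin K) (a : Fin K) {m t : ℕ} (h : m < pulls A a t) :
    ∃ s < t, A s = a ∧ pulls A a s = m := by
  induction t with
  | zero => simp [pulls] at h
  | succ t ih =>
    by_cases hm : m < pulls A a t
    · obtain ⟨s, hs, h1⟩ := ih hm
      exact ⟨s, by omega, h1⟩
    · rw [pulls_succ] at h
      split_ifs at h with h1
      · exact ⟨t, by omega, h1, by omega⟩
      · omega

lemma pullCount_history (z : ℕ → ℝ) (t : ℕ) (a : Fin K) :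
    pullCount (history π μ σ z t) a = pulls (arm π μ σ z) a t := by
  simp only [pullCount, history_apply]
  rw [Finset.card_filter, pulls_eq_sum,
    Fin.sum_univ_eq_sum_range (fun s => if arm π μ σ z s = a then 1 else 0)]

lemma empMean_history (z : ℕ → ℝ) (t : ℕ) (a : Fin K) (h : 0 < pulls (arm π μ σ z) a t) :
    empMean (history π μ σ z t) a
      = μ a + σ * (noiseSum (arm π μ σ z) z a t / pulls (arm π μ σ z) a t) := by
  have h0 : (pulls (arm π μ σ z) a t : ℝ) ≠ 0 := by positivity
  rw [empMean, pullCount_history]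
  simp only [history_apply]
  rw [Finset.sum_filter, Fin.sum_univ_eq_sum_range
    (fun s => if arm π μ σ z s = a then μ (arm π μ σ z s) + σ * z s else 0)]
  have : ∑ s ∈ Finset.range t,
      (if arm π μ σ z s = a then μ (arm π μ σ z s) + σ * z s else 0)
      = μ a * pulls (arm π μ σ z) a t + σ * noiseSum (arm π μ σ z) z a t := by
    rw [pulls_eq_sum, noiseSum, Nat.cast_sum, Finset.mul_sum, Finset.mul_sum,
      ← Finset.sum_add_distrib]
    refine Finset.sum_congr rfl fun s _ => ?_
    split_ifs with h1 <;> simp [h1]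
  rw [this]
  field_simp

variable {π μ σ} {γ : ℝ}

/-- Pigeonhole: during the first `K` rounds no arm is repeated, and the counts sum to `K`. -/
lemma IsUCB1.pulls_pos (hπ : IsUCB1 π σ γ) (z : ℕ → ℝ) {t : ℕ} (ht : K ≤ t) (a : Fin K) :
    0 < pulls (arm π μ σ z) a t := by
  have h1 : ∀ t ≤ K, ∀ a, pulls (arm π μ σ z) a t ≤ 1 := by
    intro t
    induction t with
    | zero => simp [pulls]
    | succ t ih =>
      intro ht a
      have h2 := ih (by omega) a
      have h3 := hπ.initial t (history π μ σ z t) (by omega)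
      rw [pullCount_history] at h3
      rw [pulls_succ]
      split_ifs with h
      · rw [← h, arm, h3]
      · simpa using h2
  refine lt_of_lt_of_le ?_ (pulls_mono _ a ht)
  by_contra h0
  have h2 : ∑ a, pulls (arm π μ σ z) a K < ∑ _a : Fin K, 1 :=
    Finset.sum_lt_sum (fun b _ => h1 K le_rfl b) ⟨a, Finset.mem_univ _, by omega⟩
  rw [sum_pulls] at h2
  simp at h2

lemma IsUCB1.index_le (hπ : IsUCB1 π σ γ) (hσ : 0 < σ) (z : ℕ → ℝ) {t : ℕ} (ht : K ≤ t)
    (a : Fin K) :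
    let A := arm π μ σ z
    μ a / σ + noiseSum A z a t / pulls A a t + γ / Real.sqrt (pulls A a t)
      ≤ μ (A t) / σ + noiseSum A z (A t) t / pulls A (A t) t
        + γ / Real.sqrt (pulls A (A t) t) := by
  intro A
  have hp : ∀ a, 0 < pulls A a t := hπ.pulls_pos z ht
  have h := hπ.greedy t (history π μ σ z t) ht
    (fun a => by rw [pullCount_history]; exact hp a) a
  change _ ≤ ucbIndex σ γ (history π μ σ z t) (A t) at h
  simp only [ucbIndex] at h
  rw [empMean_history _ _ _ _ _ _ (hp a), empMean_history _ _ _ _ _ _ (hp (A t)),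
    pullCount_history, pullCount_history] at h
  have e : ∀ x y w : ℝ, x + σ * y + σ * γ / w = σ * (x / σ + y + γ / w) := by
    intro x y w; field_simp
  rw [e, e] at h
  exact le_of_mul_le_mul_left h hσ

/-- If the optimal arm `o` is pulled for the `(m + 1)`-st time with `m ≥ x T`, while all other arms
have the gap `σ γ √(K / T)`, then the noises of the arms cannot all be small. -/
lemma IsUCB1.exists_noise_large (hπ : IsUCB1 π σ γ) (hσ : 0 < σ) (hγ : 0 < γ) (hK : 2 ≤ K)
    {T : ℕ} (hT : 0 < T) {o : Fin K} {M x δ : ℝ} (hx : 0 < x) (hδ : 0 < δ)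
    (hδ1 : δ < 1)
    (hnum : K * (1 - x) * (1 + (1 + δ) / Real.sqrt (x * K)) ^ 2 < (K - 1 - δ * K) * (1 - δ) ^ 2)
    (hμ : ∀ a, μ a = if a = o then M else M - σ * γ * Real.sqrt (K / T))
    (z : ℕ → ℝ) {τ m : ℕ} (hτ : τ < T) (hm : x * T ≤ m) :
    let A := arm π μ σ z
    A τ = o → pulls A o τ = m → noiseSum A z o τ ≤ δ * γ * Real.sqrt (pulls A o τ) →
    ∀ bad : Finset (Fin K), bad.card ≤ δ * K →
    (∀ a ∉ bad, a ≠ o → 0 < pulls A a τ →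
      -(δ * γ * Real.sqrt (pulls A a τ)) ≤ noiseSum A z a τ) → False := by
  intro A hA hmo hSo bad hbad hgood
  have hT' : (0 : ℝ) < T := by exact_mod_cast hT
  have hK' : (0 : ℝ) < K := by positivity
  have hmpos : 0 < (m : ℝ) := lt_of_lt_of_le (by positivity) hm
  -- In the initial rounds only unpulled arms are played, whereas `o` has been pulled `m > 0` times.
  have hKτ : K ≤ τ := by
    by_contra h
    have h3 := hπ.initial τ (history π μ σ z τ) (by omega)
    rw [pullCount_history] at h3
    change pulls A (A τ) τ = 0 at h3
    rw [hA, hmo] at h3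
    simp [h3] at hmpos
  have hp : ∀ a, 0 < pulls A a τ := hπ.pulls_pos z hKτ
  set Q := 1 + (1 + δ) / Real.sqrt (x * K) with hQ
  have hQ0 : 0 < Q := by positivity
  -- The index comparison gives `(1 - δ)/√n ≤ √(K/T) Q`, hence a lower bound on the pulls `n` of
  -- every good arm.
  have key : ∀ a ∉ bad, a ≠ o → (1 - δ) ^ 2 * T ≤ pulls A a τ * (K * Q ^ 2) := by
    intro a ha hao
    have h := hπ.index_le (μ := μ) hσ z hKτ a
    simp only at h
    change μ a / σ + noiseSum A z a τ / pulls A a τ + γ / Real.sqrt (pulls A a τ)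
      ≤ μ (A τ) / σ + noiseSum A z (A τ) τ / pulls A (A τ) τ
        + γ / Real.sqrt (pulls A (A τ) τ) at h
    rw [hA, hμ a, hμ o, if_neg hao, if_pos rfl] at h
    have hn : (0 : ℝ) < pulls A a τ := by exact_mod_cast hp a
    have hno : (0 : ℝ) < pulls A o τ := by exact_mod_cast hp o
    set n : ℝ := (pulls A a τ : ℝ)
    set no : ℝ := (pulls A o τ : ℝ) with hnodef
    have e : ∀ r : ℝ, δ * γ / Real.sqrt r * r = δ * γ * Real.sqrt r := fun r => by
      rw [div_mul_eq_mul_div, mul_div_assoc, Real.div_sqrt]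
    have h1 : -(δ * γ / Real.sqrt n) ≤ noiseSum A z a τ / n := by
      rw [le_div_iff₀ hn]
      rw [neg_mul, e]
      exact hgood a ha hao (hp a)
    have h2 : noiseSum A z o τ / no ≤ δ * γ / Real.sqrt no := by
      rw [div_le_iff₀ hno]
      rwa [e]
    have h3 : (M - σ * γ * Real.sqrt (K / T)) / σ = M / σ - γ * Real.sqrt (K / T) := by
      field_simp
    rw [h3] at h
    have h4 : (1 + δ) / Real.sqrt no ≤ Real.sqrt (K / T) * ((1 + δ) / Real.sqrt (x * K)) := by
      have h5 : Real.sqrt (x * K) = Real.sqrt (K / T) * Real.sqrt (x * T) := by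
        rw [← Real.sqrt_mul (by positivity)]
        congr 1
        field_simp
      have h6 : Real.sqrt (x * T) ≤ Real.sqrt no :=
        Real.sqrt_le_sqrt (by rw [hnodef, hmo]; exact hm)
      rw [h5]
      have : 0 < Real.sqrt (x * T) := by positivity
      have : 0 < Real.sqrt (K / T) := by positivity
      calc (1 + δ) / Real.sqrt no ≤ (1 + δ) / Real.sqrt (x * T) := by gcongr
        _ = _ := by field_simp
    have h7 : γ * ((1 - δ) / Real.sqrt n) ≤ γ * (Real.sqrt (K / T) * Q) := by
      have e1 : γ * ((1 - δ) / Real.sqrt n) = γ / Real.sqrt n - δ * γ / Real.sqrt n := by ring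
      have e2 : γ * ((1 + δ) / Real.sqrt no) = γ / Real.sqrt no + δ * γ / Real.sqrt no := by ring
      have e3 : γ * (Real.sqrt (K / T) * Q)
          = γ * Real.sqrt (K / T) + γ * (Real.sqrt (K / T) * ((1 + δ) / Real.sqrt (x * K))) := by
        rw [hQ]; ring
      have e4 := mul_le_mul_of_nonneg_left h4 hγ.le
      linarith
    have h8 := le_of_mul_le_mul_left h7 hγ
    have h9 : ((1 - δ) / Real.sqrt n) ^ 2 ≤ (Real.sqrt (K / T) * Q) ^ 2 :=
      pow_le_pow_left₀ (by have := sub_pos.2 hδ1; positivity) h8 2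
    rw [div_pow, mul_pow, Real.sq_sqrt hn.le, Real.sq_sqrt (by positivity), div_mul_eq_mul_div,
      div_le_div_iff₀ hn hT'] at h9
    linarith
  have hsum : ∑ a ∈ Finset.univ \ insert o bad, (pulls A a τ : ℝ) + m ≤ T := by
    have h1 : ∑ a ∈ insert o (Finset.univ \ insert o bad), pulls A a τ ≤ ∑ a, pulls A a τ :=
      Finset.sum_le_sum_of_subset (Finset.subset_univ _)
    rw [Finset.sum_insert (by simp), sum_pulls, hmo] at h1
    have h2 : ∑ a ∈ Finset.univ \ insert o bad, pulls A a τ + m ≤ T := by omega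
    exact_mod_cast h2
  have hcard : (K : ℝ) - 1 - δ * K ≤ ((Finset.univ \ insert o bad).card : ℝ) := by
    have h1 := Finset.le_card_sdiff (insert o bad) (Finset.univ : Finset (Fin K))
    have h2 := Finset.card_insert_le o bad
    rw [Finset.card_fin] at h1
    have h3 : K ≤ (Finset.univ \ insert o bad).card + (bad.card + 1) := by omega
    have h4 : (K : ℝ) ≤ (Finset.univ \ insert o bad).card + (bad.card + 1) := by exact_mod_cast h3
    linarith
  have h1 : ((Finset.univ \ insert o bad).card : ℝ) * ((1 - δ) ^ 2 * T)
      ≤ (∑ a ∈ Finset.univ \ insert o bad, (pulls A a τ : ℝ)) * (K * Q ^ 2) := by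
    rw [Finset.sum_mul, ← nsmul_eq_mul]
    refine Finset.card_nsmul_le_sum _ _ _ fun a ha => ?_
    simp only [Finset.mem_sdiff, Finset.mem_univ, true_and, Finset.mem_insert, not_or] at ha
    exact key a ha.2 ha.1
  have h2 : (K - 1 - δ * K) * ((1 - δ) ^ 2 * T) ≤ (T - x * T) * (K * Q ^ 2) :=
    calc _ ≤ _ := mul_le_mul_of_nonneg_right hcard (by positivity)
      _ ≤ _ := h1
      _ ≤ _ := mul_le_mul_of_nonneg_right (by linarith) (by positivity)
  have h3 := mul_lt_mul_of_pos_right hnum hT'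
  linarith

end Path

/-! ### From the trajectory bound to expected regret -/

section Regret

variable {Ω : Type u} {K T : ℕ} {ξ : ℕ → Ω → ℝ} {π : Policy K} {μ : Fin K → ℝ} {σ γ : ℝ}

lemma measurable_pulls [MeasurableSpace Ω] (t : ℕ) (h : ∀ s, s + 1 < t → Measurable (ξ s))
    (a : Fin K) : Measurable fun ω => pulls (arm π μ σ fun s => ξ s ω) a t := by
  simp_rw [pulls_eq_sum]
  refine Finset.measurable_fun_sum _ fun s hs => ?_
  have hs := Finset.mem_range.1 hs
  exact (measurable_of_finite fun b : Fin K => if b = a then 1 else 0).comp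
    (measurable_arm π μ σ s fun r hr => h r (by omega))

/-- The arm `a` is pulled in round `s`, and the arm `o` has then been pulled at most `m` times. -/
def pullEvent (ξ : ℕ → Ω → ℝ) (π : Policy K) (μ : Fin K → ℝ) (σ : ℝ) (o : Fin K) (m : ℕ)
    (a : Fin K) (s : ℕ) : Set Ω :=
  {ω | arm π μ σ (fun r => ξ r ω) s = a ∧ pulls (arm π μ σ fun r => ξ r ω) o (s + 1) ≤ m}

/-- The arm of round `s`, and so the count up to and including it, depends only on the noises before
`s`: the selection is predictable. -/
lemma measurableSet_pullEvent (o : Fin K) (m : ℕ) (a : Fin K) (s : ℕ) :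
    MeasurableSet[past ξ s] (pullEvent ξ π μ σ o m a s) := by
  have h1 := @measurable_arm K π μ σ Ω (past ξ s) ξ s fun r hr => measurable_past ξ hr
  have h2 := @measurable_pulls Ω K ξ π μ σ (past ξ s) (s + 1)
    (fun r hr => measurable_past ξ (by omega)) o
  exact (h1 (measurableSet_singleton a)).inter (h2 measurableSet_Iic)

/-- Round `τ` raises the count of `o` to `m + 1`, so selection stops exactly before it. A sum up to
the random round `τ` becomes one over the fixed horizon `T`. -/
lemma sum_pullEvent {o a : Fin K} {m τ : ℕ} (hτ : τ < T) (ω : Ω) (f : ℕ → Ω → ℝ)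
    (h1 : arm π μ σ (fun r => ξ r ω) τ = o)
    (h2 : pulls (arm π μ σ fun r => ξ r ω) o τ = m) :
    ∑ s ∈ Finset.range T, (pullEvent ξ π μ σ o m a s).indicator (f s) ω
      = ∑ s ∈ Finset.range τ, if arm π μ σ (fun r => ξ r ω) s = a then f s ω else 0 := by
  classical
  rw [← Finset.sum_subset (Finset.range_subset_range.2 hτ.le)]
  · refine Finset.sum_congr rfl fun s hs => ?_
    have hs := Finset.mem_range.1 hs
    have h3 : pulls (arm π μ σ fun r => ξ r ω) o (s + 1) ≤ m :=
      h2 ▸ pulls_mono _ o (Nat.succ_le_of_lt hs)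
    simp [pullEvent, Set.indicator_apply, h3]
  · intro s _ hs
    have hs : τ ≤ s := by simpa using hs
    have h3 := pulls_mono (arm π μ σ fun r => ξ r ω) o (Nat.succ_le_succ hs)
    rw [Nat.succ_eq_add_one, pulls_succ, h1, if_pos rfl, h2] at h3
    refine Set.indicator_of_notMem (fun h => ?_) _
    have h4 := h.2
    simp only [Nat.succ_eq_add_one] at h3
    omega

lemma selSum_pullEvent {o a : Fin K} {m τ : ℕ} (hτ : τ < T) (ω : Ω)
    (h1 : arm π μ σ (fun r => ξ r ω) τ = o)
    (h2 : pulls (arm π μ σ fun r => ξ r ω) o τ = m) :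
    selSum ξ (pullEvent ξ π μ σ o m a) T ω
      = noiseSum (arm π μ σ fun r => ξ r ω) (fun r => ξ r ω) a τ :=
  sum_pullEvent hτ ω ξ h1 h2

lemma selCount_pullEvent {o a : Fin K} {m τ : ℕ} (hτ : τ < T) (ω : Ω)
    (h1 : arm π μ σ (fun r => ξ r ω) τ = o)
    (h2 : pulls (arm π μ σ fun r => ξ r ω) o τ = m) :
    selCount (pullEvent ξ π μ σ o m a) T ω = pulls (arm π μ σ fun r => ξ r ω) a τ := by
  rw [pulls_eq_sum, selCount, sum_pullEvent hτ ω (fun _ _ => 1) h1 h2]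
  push_cast
  rfl

/-- Bound for the probability that the noises of a fixed arm are large. -/
noncomputable def tailBound (T : ℕ) (c : ℝ) : ℝ :=
  (Nat.log 2 T + 1 : ℕ) * Real.exp (-(c ^ 2 / 4))

/-- The gap vector with the optimal arm `o` whose other entries are `d`. -/
def twoLevel (o : Fin K) (d : ℝ) : Fin K → ℝ := fun a => if a = o then 0 else d

lemma twoLevel_mem (o : Fin K) {d : ℝ} (hd : 0 ≤ d) :
    twoLevel o d ∈ boundedGapVectors K d := by
  refine ⟨⟨fun a => ?_, o, by simp [twoLevel]⟩, fun a => ?_⟩ <;>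
  · unfold twoLevel
    split_ifs <;> simp [hd]

lemma gap_eq {Δ : Fin K → ℝ} (hΔ : Δ ∈ gapVectors K) (M : ℝ) (a : Fin K) :
    gap (fun b => M - Δ b) a = Δ a := by
  obtain ⟨h0, o, ho⟩ := hΔ
  have : Nonempty (Fin K) := ⟨o⟩
  have h1 : ⨆ b, (M - Δ b) = M := by
    refine le_antisymm (ciSup_le fun b => by linarith [h0 b]) ?_
    have := le_ciSup (f := fun b => M - Δ b) (Set.finite_range _).bddAbove o
    simpa [ho] using this
  simp [gap, h1]

lemma sum_gap_twoLevel (o : Fin K) {d : ℝ} (hd : 0 ≤ d) (M : ℝ) (A : ℕ → Fin K) :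
    ∑ t ∈ Finset.range T, gap (fun b => M - twoLevel o d b) (A t) = d * (T - pulls A o T) := by
  simp_rw [gap_eq (twoLevel_mem o hd).1 M]
  rw [pulls_eq_sum, Nat.cast_sum]
  have : (T : ℝ) = ∑ s ∈ Finset.range T, 1 := by simp
  rw [this, ← Finset.sum_sub_distrib, Finset.mul_sum]
  refine Finset.sum_congr rfl fun t _ => ?_
  unfold twoLevel
  split_ifs <;> simp

variable [mΩ : MeasurableSpace Ω] {P : Measure Ω}

lemma regret_congr_ae {ξ' : ℕ → Ω → ℝ} (h : ∀ t < T, ξ t =ᵐ[P] ξ' t) :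
    regret P ξ π μ σ T = regret P ξ' π μ σ T := by
  refine integral_congr_ae ?_
  have h1 : ∀ᵐ ω ∂P, ∀ t < T, ξ t ω = ξ' t ω :=
    ae_all_iff.2 fun t => by
      by_cases ht : t < T
      · filter_upwards [h t ht] with ω hω _ using hω
      · exact ae_of_all _ fun ω h => absurd h ht
  filter_upwards [h1] with ω hω
  refine Finset.sum_congr rfl fun t ht => ?_
  rw [arm_congr π μ σ t fun s hs => hω s (hs.trans (Finset.mem_range.1 ht))]

variable [IsProbabilityMeasure P]

/-- With high probability the optimal arm is pulled at most `m` times. -/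
lemma IsUCB1.measure_pulls_le (hπ : IsUCB1 π σ γ) (hξ : IsGaussianNoise P T ξ)
    (hm : ∀ t, Measurable (ξ t)) (hσ : 0 < σ) (hγ : 0 < γ) (hK : 2 ≤ K)
    (hT : 0 < T) {o : Fin K} {M x δ : ℝ} (hx : 0 < x) (hδ : 0 < δ) (hδ1 : δ < 1)
    (hnum : K * (1 - x) * (1 + (1 + δ) / Real.sqrt (x * K)) ^ 2 < (K - 1 - δ * K) * (1 - δ) ^ 2)
    (hμ : ∀ a, μ a = if a = o then M else M - σ * γ * Real.sqrt (K / T))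
    {m : ℕ} (hxm : x * T ≤ m) :
    P {ω | m < pulls (arm π μ σ fun s => ξ s ω) o T}
      ≤ ENNReal.ofReal ((1 + 1 / δ) * tailBound T (δ * γ)) := by
  classical
  set c := δ * γ with hc
  have hc0 : 0 < c := by positivity
  have hK' : (0 : ℝ) < K := by positivity
  have hp0 : 0 ≤ tailBound T c := by unfold tailBound; positivity
  let E : ℝ → Fin K → Set Ω := fun c a =>
    {ω | 1 ≤ selCount (pullEvent ξ π μ σ o m a) T ω ∧
      c ^ 2 * Real.sqrt (selCount (pullEvent ξ π μ σ o m a) T ω)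
        ≤ c * selSum ξ (pullEvent ξ π μ σ o m a) T ω}
  have hE : ∀ a, P (E c a) ≤ ENNReal.ofReal (tailBound T c) := fun a =>
    hξ.measure_sel_le hm (measurableSet_pullEvent o m a) c
  have hE' : ∀ a, P (E (-c) a) ≤ ENNReal.ofReal (tailBound T c) := fun a => by
    have h := hξ.measure_sel_le hm (measurableSet_pullEvent (π := π) (μ := μ) (σ := σ) o m a) (-c)
    rw [neg_sq] at h
    refine le_trans (measure_mono ?_) h
    intro ω hω
    simpa [E] using hω
  have hEm : ∀ a, MeasurableSet (E (-c) a) := fun a => by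
    have h1 := (measurable_selSum (measurableSet_pullEvent (ξ := ξ) (π := π) (μ := μ) (σ := σ)
      o m a) T).mono (past_le hm T) le_rfl
    have h2 := (measurable_selCount (measurableSet_pullEvent (ξ := ξ) (π := π) (μ := μ) (σ := σ)
      o m a) T).mono (past_le hm T) le_rfl
    exact (measurableSet_le measurable_const h2).inter
      (measurableSet_le (h2.sqrt.const_mul _) (h1.const_mul _))
  -- Number of arms with a large negative noise sum; its mean is at most `K` tail bounds, so Markov
  -- at level `δK` costs the factor `1/δ`.
  let f : Ω → ENNReal := fun ω => ∑ a, (E (-c) a).indicator 1 ω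
  have hf : ∫⁻ ω, f ω ∂P ≤ ENNReal.ofReal (K * tailBound T c) := by
    rw [lintegral_finsetSum _ fun a _ => measurable_one.indicator (hEm a)]
    simp_rw [lintegral_indicator_one (hEm _)]
    refine (Finset.sum_le_sum fun a _ => hE' a).trans ?_
    rw [Finset.sum_const, Finset.card_fin, nsmul_eq_mul, ENNReal.ofReal_mul (Nat.cast_nonneg _),
      ENNReal.ofReal_natCast]
  have hfm : Measurable f :=
    Finset.measurable_fun_sum _ fun a _ => measurable_one.indicator (hEm a)
  have hF : P {ω | ENNReal.ofReal (δ * K) ≤ f ω} ≤ ENNReal.ofReal (1 / δ * tailBound T c) := by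
    refine (meas_ge_le_lintegral_div hfm.aemeasurable
      (by simpa using (by positivity : 0 < δ * K)) (by simp)).trans ?_
    refine (ENNReal.div_le_div_right hf _).trans ?_
    rw [← ENNReal.ofReal_div_of_pos (by positivity)]
    refine ENNReal.ofReal_le_ofReal (le_of_eq ?_)
    field_simp
  have hsub : {ω | m < pulls (arm π μ σ fun s => ξ s ω) o T}
      ⊆ E c o ∪ {ω | ENNReal.ofReal (δ * K) ≤ f ω} := by
    intro ω hω
    by_contra hcon
    simp only [Set.mem_union, not_or, Set.mem_ofPred_eq, not_le] at hcon
    obtain ⟨hc1, hc2⟩ := hcon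
    obtain ⟨τ, hτ, hτ1, hτ2⟩ := exists_pulls_eq _ o hω
    have hS := fun a => selSum_pullEvent (a := a) hτ ω hτ1 hτ2
    have hN := fun a => selCount_pullEvent (a := a) hτ ω hτ1 hτ2
    have hm1 : (1 : ℝ) ≤ m := by
      have : (0 : ℝ) < m := lt_of_lt_of_le (by positivity) hxm
      have : 0 < m := by exact_mod_cast this
      exact_mod_cast this
    refine hπ.exists_noise_large hσ hγ hK hT hx hδ hδ1 hnum hμ (fun s => ξ s ω) hτ hxm hτ1 hτ2
      ?_ (Finset.univ.filter fun a => ω ∈ E (-c) a) ?_ ?_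
    · simp only [E, Set.mem_ofPred_eq, hS, hN, not_and, not_le, hτ2] at hc1 ⊢
      have h := hc1 hm1
      rw [sq, mul_assoc c c] at h
      exact (lt_of_mul_lt_mul_left h hc0.le).le
    · have h1 : f ω = ((Finset.univ.filter fun a => ω ∈ E (-c) a).card : ℕ) := by
        simp only [f, Set.indicator_apply, Pi.one_apply]
        exact Finset.sum_boole _ _
      rw [h1, ← ENNReal.ofReal_natCast] at hc2
      exact (ENNReal.ofReal_lt_ofReal_iff'.1 hc2).1.le
    · intro a ha _ hpos
      simp only [E, Finset.mem_filter, Finset.mem_univ, true_and, Set.mem_ofPred_eq, hS, hN,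
        not_and, not_le] at ha
      have h := ha (by exact_mod_cast hpos)
      nlinarith
  refine (measure_mono hsub).trans ((measure_union_le _ _).trans ?_)
  rw [add_mul, one_mul, ENNReal.ofReal_add hp0 (by positivity)]
  exact add_le_add (hE o) hF

/-- Markov's inequality: if `o` has at most `m` pulls, each of the other `T - m` rounds costs `d`.
-/
lemma regret_twoLevel_ge (hm : ∀ t, Measurable (ξ t)) (o : Fin K) {d : ℝ} (hd : 0 ≤ d) (M : ℝ)
    (m : ℕ) (hmT : m ≤ T) :
    d * (T - m) * (1 - P.real {ω | m < pulls
      (arm π (fun a => M - twoLevel o d a) σ fun s => ξ s ω) o T})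
      ≤ regret P ξ π (fun a => M - twoLevel o d a) σ T := by
  unfold regret
  simp_rw [sum_gap_twoLevel o hd M]
  have hpm := measurable_pulls (π := π) (μ := fun a => M - twoLevel o d a) (σ := σ) T
    (fun s _ => hm s) o
  set N := fun ω => pulls (arm π (fun a => M - twoLevel o d a) σ fun s => ξ s ω) o T with hN
  have hNT : ∀ ω, (N ω : ℝ) ≤ T := fun ω => by
    exact_mod_cast Nat.count_le (p := fun s => arm π (fun a => M - twoLevel o d a) σ
      (fun s => ξ s ω) s = o) (n := T)
  have hFm : Measurable fun ω => d * ((T : ℝ) - N ω) :=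
    (measurable_const.sub ((measurable_of_countable (fun n : ℕ => (n : ℝ))).comp hpm)).const_mul d
  have hF0 : ∀ ω, 0 ≤ d * ((T : ℝ) - N ω) := fun ω => mul_nonneg hd (sub_nonneg.2 (hNT ω))
  have hFi : Integrable (fun ω => d * ((T : ℝ) - N ω)) P := by
    refine Integrable.of_bound hFm.aestronglyMeasurable (d * T) (ae_of_all _ fun ω => ?_)
    rw [Real.norm_of_nonneg (hF0 ω)]
    exact mul_le_mul_of_nonneg_left (sub_le_self _ (Nat.cast_nonneg _)) hd
  have h1 := mul_meas_ge_le_integral_of_nonneg (ae_of_all _ hF0) hFi (d * (T - m))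
  refine le_trans (mul_le_mul_of_nonneg_left ?_ ?_) h1
  · have hms : MeasurableSet {ω | m < N ω} := hpm measurableSet_Ioi
    rw [← probReal_compl_eq_one_sub hms]
    refine measureReal_mono fun ω hω => ?_
    have h2 : N ω ≤ m := not_lt.1 hω
    have h3 : (N ω : ℝ) ≤ m := by exact_mod_cast h2
    exact mul_le_mul_of_nonneg_left (by linarith) hd
  · have : (m : ℝ) ≤ T := by exact_mod_cast hmT
    exact mul_nonneg hd (by linarith)

/-- Lower bound for the regret if all gaps but one are equal to `σ γ √(K / T)`. -/
lemma IsUCB1.regret_ge (hπ : IsUCB1 π σ γ) (hξ : IsGaussianNoise P T ξ)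
    (hσ : 0 < σ) (hγ : 0 < γ) (hK : 2 ≤ K) (hT : 0 < T) (o : Fin K) (M : ℝ) {x δ : ℝ}
    (hx : 0 < x) (hx1 : x < 1) (hδ : 0 < δ) (hδ1 : δ < 1)
    (hnum : K * (1 - x) * (1 + (1 + δ) / Real.sqrt (x * K)) ^ 2 < (K - 1 - δ * K) * (1 - δ) ^ 2)
    (hp : (1 + 1 / δ) * tailBound T (δ * γ) ≤ 1) :
    γ * Real.sqrt (K * T) * ((1 - x - 1 / T) * (1 - (1 + 1 / δ) * tailBound T (δ * γ)))
      ≤ regret P ξ π (fun a => M - twoLevel o (σ * γ * Real.sqrt (K / T)) a) σ T / σ := by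
  obtain ⟨ξ', hm, hξ', hae⟩ := hξ.exists_measurable
  rw [regret_congr_ae hae, le_div_iff₀ hσ]
  have hT' : (0 : ℝ) < T := by exact_mod_cast hT
  set d := σ * γ * Real.sqrt (K / T) with hd
  have hd0 : 0 ≤ d := by positivity
  -- Rounding `xT` up to an integer loses at most one round, whence the `1 / T` in the bound.
  have hmT : ⌈x * T⌉₊ ≤ T := Nat.ceil_le.2 (by nlinarith)
  have h1 := regret_twoLevel_ge (P := P) (π := π) (σ := σ) hm o hd0 M _ hmT
  have h2 := hπ.measure_pulls_le hξ' hm hσ hγ hK hT (o := o) (M := M) hx hδ hδ1 hnum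
    (μ := fun a => M - twoLevel o d a)
    (fun a => by simp only [twoLevel]; split_ifs <;> simp [hd]) (Nat.le_ceil _)
  have hp0 : 0 ≤ tailBound T (δ * γ) := by unfold tailBound; positivity
  have h3 := ENNReal.toReal_mono ENNReal.ofReal_ne_top h2
  rw [ENNReal.toReal_ofReal (by positivity)] at h3
  refine le_trans ?_ h1
  have h4 : Real.sqrt (K * T) = Real.sqrt (K / T) * T := by
    nth_rewrite 3 [← Real.sqrt_sq hT'.le]
    rw [← Real.sqrt_mul (by positivity)]
    congr 1
    field_simp
  have h5 : γ * Real.sqrt (K * T) * ((1 - x - 1 / T) * (1 - (1 + 1 / δ) * tailBound T (δ * γ))) * σ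
      = d * ((1 - x) * T - 1) * (1 - (1 + 1 / δ) * tailBound T (δ * γ)) := by
    rw [h4, hd]
    field_simp
  rw [h5]
  have h6 : (⌈x * T⌉₊ : ℝ) ≤ x * T + 1 := (Nat.ceil_lt_add_one (by positivity)).le
  have h7 : (⌈x * T⌉₊ : ℝ) ≤ T := by exact_mod_cast hmT
  refine mul_le_mul (mul_le_mul_of_nonneg_left (by linarith) hd0) ?_ (by linarith)
    (mul_nonneg hd0 (by linarith))
  exact sub_le_sub_left h3 1

end Regret

/-! ### Asymptotics of the rate and numerical constants -/

lemma rate_pos {T : ℕ} (hT : 2 ≤ T) : 0 < rate T := by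
  have : 0 < Real.log T := Real.log_pos (by exact_mod_cast hT)
  unfold rate
  positivity

lemma tailBound_rate_le {T : ℕ} (hT : 2 ≤ T) (δ : ℝ) :
    tailBound T (δ * rate T)
      ≤ (Real.log T / Real.log 2 + 1) * (T : ℝ) ^ (-(δ ^ 2 / 2)) := by
  have h0 : 0 ≤ Real.log T := Real.log_natCast_nonneg T
  have hT' : (0 : ℝ) < T := by positivity
  have h1 : ((Nat.log 2 T + 1 : ℕ) : ℝ) ≤ Real.log T / Real.log 2 + 1 := by
    have := Real.natLog_le_logb T 2
    rw [Real.logb] at this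
    push_cast at this ⊢
    linarith
  have h2 : Real.exp (-((δ * rate T) ^ 2 / 4)) = (T : ℝ) ^ (-(δ ^ 2 / 2)) := by
    rw [Real.rpow_def_of_pos hT', mul_pow, rate, Real.sq_sqrt (by positivity)]
    congr 1
    ring
  rw [tailBound, h2]
  gcongr

/-- At this rate the Gaussian factor is `T ^ (-(δ²/2))`, which beats the logarithmic number of
dyadic blocks. -/
lemma tendsto_tailBound_rate {δ : ℝ} (hδ : 0 < δ) :
    Filter.Tendsto (fun T : ℕ => tailBound T (δ * rate T)) Filter.atTop (nhds 0) := by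
  have hr : 0 < δ ^ 2 / 2 := by positivity
  have h1 : Filter.Tendsto (fun x : ℝ => Real.log x / x ^ (δ ^ 2 / 2)) Filter.atTop (nhds 0) :=
    (isLittleO_log_rpow_atTop hr).tendsto_div_nhds_zero
  have h2 : Filter.Tendsto (fun x : ℝ => x ^ (-(δ ^ 2 / 2))) Filter.atTop (nhds 0) :=
    tendsto_rpow_neg_atTop hr
  have h3 := ((h1.div_const (Real.log 2)).add h2).comp tendsto_natCast_atTop_atTop
  simp only [zero_div, add_zero] at h3
  refine tendsto_of_tendsto_of_tendsto_of_le_of_le' tendsto_const_nhds h3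
    (Filter.Eventually.of_forall fun T => by unfold tailBound; positivity) ?_
  filter_upwards [Filter.eventually_ge_atTop 2] with T hT
  refine (tailBound_rate_le hT δ).trans (le_of_eq ?_)
  have hT' : (0 : ℝ) < T := by positivity
  simp only [Function.comp, Real.rpow_neg hT'.le]
  field_simp

/-- The condition of `IsUCB1.regret_ge` for `δ = 1 / 100` and a share `x` of pulls of the optimal
arm that leaves more than the share `(1 - 1 / K) / 4`, and `1 / 4` if `4 ≤ K`. -/
lemma exists_share {K : ℕ} (hK : 2 ≤ K) : ∃ x : ℝ, 0 < x ∧ x < 1 ∧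
    K * (1 - x) * (1 + (1 + 1 / 100) / Real.sqrt (x * K)) ^ 2
      < (K - 1 - 1 / 100 * K) * (1 - 1 / 100) ^ 2 ∧
    (1 - 1 / (K : ℝ)) / 4 ≤ (1 - x - 1 / 1000) * (1 - 1 / 100) ∧
    (4 ≤ K → 1 / 4 ≤ (1 - x - 1 / 1000) * (1 - 1 / 100)) := by
  have key : ∀ x q : ℝ, 0 < q → q ^ 2 ≤ x * K → x < 1 →
      K * (1 - x) * (1 + (1 + 1 / 100) / q) ^ 2 < (K - 1 - 1 / 100 * K) * (1 - 1 / 100) ^ 2 →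
      K * (1 - x) * (1 + (1 + 1 / 100) / Real.sqrt (x * K)) ^ 2
      < (K - 1 - 1 / 100 * K) * (1 - 1 / 100) ^ 2 := by
    intro x q hq hqx hx h
    refine lt_of_le_of_lt ?_ h
    have h1 : q ≤ Real.sqrt (x * K) := Real.le_sqrt_of_sq_le hqx
    have h2 : 0 ≤ 1 - x := by linarith
    gcongr
  -- In each case `q` is a rational just below `√(xK)`, with `K = 4` the worst case in the last one.
  -- There the bound on `Q` is uniform in `K`, and the inequality becomes linear in `K`.
  obtain rfl | rfl | h4 : K = 2 ∨ K = 3 ∨ 4 ≤ K := by omega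
  · exact ⟨0.86, by norm_num, by norm_num, key _ 1.31 (by norm_num) (by norm_num) (by norm_num)
      (by norm_num), by norm_num, by norm_num⟩
  · exact ⟨0.8, by norm_num, by norm_num, key _ 1.54 (by norm_num) (by norm_num) (by norm_num)
      (by norm_num), by norm_num, by norm_num⟩
  · have h4' : (4 : ℝ) ≤ K := by exact_mod_cast h4
    have h5 : 0 ≤ 1 / (K : ℝ) := by positivity
    refine ⟨0.74, by norm_num, by norm_num, key _ 1.72 (by norm_num) (by linarith) (by norm_num)
      ?_, by linarith, fun _ => by norm_num⟩
    norm_num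
    linarith

lemma rate_mul_sqrt (T K : ℕ) :
    1 / Real.sqrt 8 * Real.sqrt (T * K * Real.log T) = rate T * Real.sqrt (K * T) * (1 / 4) := by
  have h8 : Real.sqrt 8 = 2 * Real.sqrt 2 := by
    rw [show (8 : ℝ) = 2 ^ 2 * 2 by norm_num, Real.sqrt_mul (by norm_num),
      Real.sqrt_sq (by norm_num)]
  have h2 : Real.sqrt 2 * Real.sqrt 2 = 2 := Real.mul_self_sqrt (by norm_num)
  rw [rate, h8, mul_comm (T : ℝ), Real.sqrt_mul (by positivity) (Real.log T),
    Real.sqrt_mul (by norm_num) (Real.log T)]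
  field_simp
  rw [sq, h2]
  ring

lemma err_nonneg (T K : ℕ) : 0 ≤ err T K := by unfold err; positivity

lemma max_mul_sqrt_le {T K : ℕ} {c y C R : ℝ} (hC : 0 ≤ C) (hc : 0 ≤ c) (hcy : c / 4 ≤ y)
    (hR : rate T * Real.sqrt (K * T) * y ≤ R) :
    max (c / Real.sqrt 8 - C * err T K) 0 * Real.sqrt (T * K * Real.log T) ≤ R := by
  have h0 : 0 ≤ rate T * Real.sqrt (K * T) := mul_nonneg (Real.sqrt_nonneg _) (Real.sqrt_nonneg _)
  calc _ ≤ c / Real.sqrt 8 * Real.sqrt (T * K * Real.log T) := by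
        refine mul_le_mul_of_nonneg_right (max_le ?_ (by positivity)) (Real.sqrt_nonneg _)
        exact sub_le_self _ (mul_nonneg hC (err_nonneg T K))
    _ = rate T * Real.sqrt (K * T) * (c / 4) := by
        linear_combination c * rate_mul_sqrt T K
    _ ≤ _ := mul_le_mul_of_nonneg_left hcy h0
    _ ≤ R := hR

/-! ### Lower bounds for the supremum -/

section

variable {Ω : Type u} [MeasurableSpace Ω] {P : Measure Ω} {K T : ℕ} {ξ : ℕ → Ω → ℝ}
  {π : Policy K} {σ : ℝ}

lemma le_maxScaledRegret {D : Set (Fin K → ℝ)} {Δ : Fin K → ℝ} (hΔ : Δ ∈ D) {m r : ℝ}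
    (h : r ≤ regret P ξ π (fun a => m - Δ a) σ T / σ) :
    (r : EReal) ≤ maxScaledRegret P ξ π m σ T D :=
  (EReal.coe_le_coe_iff.2 h).trans
    (le_iSup₂ (f := fun Δ (_ : Δ ∈ D) =>
      ((regret P ξ π (fun a => m - Δ a) σ T / σ : ℝ) : EReal)) Δ hΔ)

/-- Every arm is pulled at least once, so that unbounded gaps cause unbounded regret. -/
lemma IsUCB1.maxScaledRegret_gapVectors [IsProbabilityMeasure P] {γ : ℝ} (hπ : IsUCB1 π σ γ)
    (hξ : IsGaussianNoise P T ξ) (hσ : 0 < σ) (hK : 2 ≤ K) (hKT : K ≤ T) (m : ℝ) :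
    maxScaledRegret P ξ π m σ T (gapVectors K) = ⊤ := by
  rw [EReal.eq_top_iff_forall_lt]
  intro y
  obtain ⟨ξ', hm, -, hae⟩ := hξ.exists_measurable
  -- With `m = T - 1` the exceptional event is empty, since another arm takes at least one round;
  -- the regret is thus at least the gap.
  have h1 := regret_twoLevel_ge (P := P) (π := π) (σ := σ) (T := T) hm ⟨0, by omega⟩
    (d := σ * (|y| + 1)) (by positivity) m (T - 1) (by omega)
  have h2 : ∀ ω, pulls (arm π (fun a => m - twoLevel ⟨0, by omega⟩ (σ * (|y| + 1)) a) σ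
      fun s => ξ' s ω) ⟨0, by omega⟩ T ≤ T - 1 := by
    intro ω
    set A := arm π (fun a => m - twoLevel ⟨0, by omega⟩ (σ * (|y| + 1)) a) σ fun s => ξ' s ω
    have h3 := sum_pulls A T
    have h4 : 0 < pulls A ⟨1, by omega⟩ T := hπ.pulls_pos _ hKT _
    have h5 : ∑ a ∈ {⟨0, by omega⟩, ⟨1, by omega⟩}, pulls A a T ≤ ∑ a, pulls A a T :=
      Finset.sum_le_sum_of_subset (Finset.subset_univ _)
    rw [Finset.sum_pair (by simp)] at h5
    omega
  have h3 : {ω | T - 1 < pulls (arm π (fun a => m - twoLevel ⟨0, by omega⟩ (σ * (|y| + 1)) a) σ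
      fun s => ξ' s ω) ⟨0, by omega⟩ T} = ∅ :=
    Set.eq_empty_of_forall_notMem fun ω hω => absurd (h2 ω) (not_le.2 hω)
  rw [h3, measureReal_empty, ← regret_congr_ae hae, Nat.cast_sub (by omega)] at h1
  refine lt_of_lt_of_le (EReal.coe_lt_coe_iff.2 (show y < |y| + 1 by linarith [le_abs_self y])) ?_
  refine le_maxScaledRegret (twoLevel_mem ⟨0, by omega⟩ (d := σ * (|y| + 1)) (by positivity)).1 ?_
  rw [le_div_iff₀ hσ]
  refine le_trans (le_of_eq ?_) h1
  push_cast
  ring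

end

end Bandit

/-! ### Choice of constants and the four bounds -/

theorem mainTheorem6 :
    ∃ C : ℝ, 0 < C ∧ ∃ T₀ : ℝ → ℕ,
      ∀ (Ω : Type u) [MeasurableSpace Ω] (P : Measure Ω) [IsProbabilityMeasure P]
        (K T : ℕ) (ξ : ℕ → Ω → ℝ) (π : Bandit.Policy K) (m σ : ℝ),
        2 ≤ K → 0 < T → 0 < σ → (K : ℝ) / T ≤ 1 / C →
        Bandit.IsGaussianNoise P T ξ →
        Bandit.IsUCB1 π σ (Bandit.rate T) →
          (((max (1 / Real.sqrt 8 - C * Bandit.err T K) 0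
                * Real.sqrt (T * K * Real.log T) : ℝ) : EReal)
              ≤ Bandit.maxScaledRegret P ξ π m σ T (Bandit.gapVectors K)) ∧
          (((max ((1 - 1 / (K : ℝ)) / Real.sqrt 8 - C * Bandit.err T K) 0
                * Real.sqrt (T * K * Real.log T) : ℝ) : EReal)
              ≤ Bandit.maxScaledRegret P ξ π m σ T
                  (Bandit.boundedGapVectors K (σ * Bandit.rate T * Real.sqrt ((K : ℝ) / T)))) ∧
          (4 ≤ K →
            ((max (1 / Real.sqrt 8 - C * Bandit.err T K) 0
                * Real.sqrt (T * K * Real.log T) : ℝ) : EReal)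
              ≤ Bandit.maxScaledRegret P ξ π m σ T
                  (Bandit.boundedGapVectors K (σ * Bandit.rate T * Real.sqrt ((K : ℝ) / T)))) ∧
          (∀ M : ℝ, T₀ M ≤ T →
            ((M * Real.sqrt (K * T) : ℝ) : EReal)
              < Bandit.maxScaledRegret P ξ π m σ T
                  (Bandit.boundedGapVectors K (σ * Bandit.rate T * Real.sqrt ((K : ℝ) / T)))) := by
  have hev : ∀ᶠ T : ℕ in Filter.atTop,
      (1 + 1 / (1 / 100)) * Bandit.tailBound T (1 / 100 * Bandit.rate T) ≤ 1 / 100 := by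
    have h := (Bandit.tendsto_tailBound_rate (δ := 1 / 100) (by norm_num)).const_mul
      (1 + 1 / (1 / 100))
    rw [mul_zero] at h
    exact h.eventually_le_const (by norm_num)
  obtain ⟨T₁, hT₁⟩ := Filter.eventually_atTop.1 hev
  have hrate : Filter.Tendsto Bandit.rate Filter.atTop Filter.atTop :=
    Real.tendsto_sqrt_atTop.comp (Filter.Tendsto.const_mul_atTop (by norm_num)
      (Real.tendsto_log_atTop.comp tendsto_natCast_atTop_atTop))
  -- The factor `8` matches the bound `1 / 8 ≤ y` below, valid for every `K ≥ 2`.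
  choose T₀ hT₀ using fun M : ℝ => Filter.eventually_atTop.1 (hrate.eventually_gt_atTop (8 * M))
  -- `K / T ≤ 1 / C` forces `T ≥ CK`. So `T ≥ T₁` makes the failure probability at most `1/100`, and
  -- `T ≥ 1000` makes the rounding loss at most `1/1000`: the two slacks in `exists_share`.
  refine ⟨T₁ + 1000, by positivity, T₀, ?_⟩
  intro Ω _ P _ K T ξ π m σ hK hT hσ hKT hξ hπ
  have hT' : (0 : ℝ) < T := by exact_mod_cast hT
  have hK' : (2 : ℝ) ≤ K := by exact_mod_cast hK
  have hC : (0 : ℝ) < (T₁ : ℝ) + 1000 := by positivity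
  rw [div_le_div_iff₀ hT' hC, one_mul] at hKT
  have hT1 : T₁ ≤ T := by
    have : (T₁ : ℝ) ≤ T := by nlinarith [Nat.cast_nonneg (α := ℝ) T₁]
    exact_mod_cast this
  have hT1000 : (1000 : ℝ) ≤ T := by nlinarith [Nat.cast_nonneg (α := ℝ) T₁]
  have hKT' : K ≤ T := by
    have : (K : ℝ) ≤ T := by nlinarith [Nat.cast_nonneg (α := ℝ) T₁]
    exact_mod_cast this
  have hγ : 0 < Bandit.rate T := Bandit.rate_pos (hK.trans hKT')
  obtain ⟨x, hx, hx1, hnum, hx2, hx3⟩ := Bandit.exists_share hK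
  have hp := hT₁ T hT1
  set y : ℝ := (1 - x - 1 / 1000) * (1 - 1 / 100) with hy
  have hy8 : 1 / 8 ≤ y := by
    have : 1 / (K : ℝ) ≤ 1 / 2 := one_div_le_one_div_of_le (by norm_num) hK'
    linarith
  set d := σ * Bandit.rate T * Real.sqrt ((K : ℝ) / T) with hd
  set r := Bandit.rate T * Real.sqrt (K * T) with hr
  have hr0 : 0 < r := by positivity
  have hreg : r * y ≤ Bandit.regret P ξ π
      (fun a => m - Bandit.twoLevel ⟨0, by omega⟩ d a) σ T / σ := by
    refine le_trans (mul_le_mul_of_nonneg_left ?_ hr0.le)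
      (hπ.regret_ge hξ hσ hγ hK hT ⟨0, by omega⟩ m hx hx1 (δ := 1 / 100) (by norm_num)
        (by norm_num) hnum (by linarith))
    have h1 : 1 / (T : ℝ) ≤ 1 / 1000 := one_div_le_one_div_of_le (by norm_num) hT1000
    have h2 : 0 < 1 - x - 1 / 1000 := by
      by_contra h
      linarith
    rw [hy]
    refine mul_le_mul (by linarith) (by linarith) (by norm_num) (by linarith)
  have hmem := Bandit.twoLevel_mem (⟨0, by omega⟩ : Fin K) (d := d) (by positivity)
  refine ⟨?_, ?_, fun h4 => ?_, fun M hM => ?_⟩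
  · rw [hπ.maxScaledRegret_gapVectors hξ hσ hK hKT' m]
    exact le_top
  · refine Bandit.le_maxScaledRegret hmem (Bandit.max_mul_sqrt_le hC.le ?_ hx2 hreg)
    have : 1 / (K : ℝ) ≤ 1 / 2 := one_div_le_one_div_of_le (by norm_num) hK'
    linarith
  · exact Bandit.le_maxScaledRegret hmem
      (Bandit.max_mul_sqrt_le hC.le zero_le_one (hx3 h4) hreg)
  · refine lt_of_lt_of_le (EReal.coe_lt_coe_iff.2 ?_) (Bandit.le_maxScaledRegret hmem hreg)
    have h1 := hT₀ M T hM
    have h2 : 0 < Real.sqrt (K * T) := by positivity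
    calc M * Real.sqrt (K * T) < Bandit.rate T / 8 * Real.sqrt (K * T) :=
          mul_lt_mul_of_pos_right (by linarith) h2
      _ = r * (1 / 8) := by rw [hr]; ring
      _ ≤ r * y := mul_le_mul_of_nonneg_left hy8 hr0.le
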